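/- For an infinite word $\mathbf{x}=x_1x_2\cdots$ over a finite alphabet and $n\ge 1$, let $r(n,\mathbf{x})$ be the length of the shortest prefix of $\mathbf{x}$ in which some subword of length $n$ occurs twice (the two occurrences may overlap), that is, $$r(n,\mathbf{x})=\min\{m : x_jx_{j+1}\cdots x_{j+n-1}=x_{m-n+1}x_{m-n+2}\cdots x_m \text{ for some } 1\le j\le m-n\},$$ and let $\mathrm{rep}(\mathbf{x})=\liminf_{n\to\infty} r(n,\mathbf{x})/n$ be the exponent of repetition of $\mathbf{x}$. For an irrational number $\theta\in(0,1)$, the Sturmian words of slope $\theta$ are the words $x_1x_2\cdots$ over $\{0,1\}$ such that, for some real number $\rho$, either $x_n=\lfloor (n+1)\theta+\rho\rfloor-\lfloor n\theta+\rho\rfloor$ for all $n\ge 1$, or $x_n=\lceil (n+1)\theta+\rho\rceil-\lceil n\theta+\rho\rceil$ for all $n\ge 1$. Put $$\mathscr{L}(\theta)=\{\mathrm{rep}(\mathbf{x}) : \mathbf{x}\text{ is a Sturmian word of slope }\theta\}.$$ Theorem. Let $\theta\in(0,1)$ be an irrational number with regular continued fraction expansion $\theta=[0;a_1,a_2,\dots]$,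 and suppose that the partial quotients $a_k$ ($k\ge 1$) are bounded. Then the set $\mathscr{L}(\theta)$ has a least element, and $$\min\mathscr{L}(\theta)=\liminf_{k\to\infty}\,[1;1+a_k,a_{k-1},a_{k-2},\dots,a_1].$$ -/

import Mathlib

/-- `r(n, x)`: the length of the shortest prefix of the infinite word `x = x₁x₂…` in which some
subword of length `n` occurs twice. The letter `xₖ` is stored as `x (k - 1)`. The two occurrences
start at the (zero-based) positions `i < j`, and the prefix ends with the second one, so that its
length is `m = j + n`; the occurrences may overlap. Over a finite alphabet the set of such `m` is
non-empty (`repetitionLengths_nonempty`). -/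
noncomputable def repetitionLength {α : Type*} (x : ℕ → α) (n : ℕ) : ℕ :=
  sInf {m : ℕ | ∃ i j : ℕ, i < j ∧ m = j + n ∧ ∀ l < n, x (i + l) = x (j + l)}

theorem repetitionLengths_nonempty {α : Type*} [Finite α] (x : ℕ → α) (n : ℕ) :
    {m : ℕ | ∃ i j : ℕ, i < j ∧ m = j + n ∧ ∀ l < n, x (i + l) = x (j + l)}.Nonempty := by
  obtain ⟨i, j, hne, h⟩ := Finite.exists_ne_map_eq_of_infinite
    (fun (i : ℕ) (l : Fin n) => x (i + l))
  rcases lt_or_gt_of_ne hne with hij | hij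
  · exact ⟨_, i, j, hij, rfl, fun l hl => congrFun h ⟨l, hl⟩⟩
  · exact ⟨_, j, i, hij, rfl, fun l hl => (congrFun h ⟨l, hl⟩).symm⟩

/-- The exponent of repetition `rep(x) = liminf r(n, x) / n`, as an extended real number
(for a general infinite word it may be `+∞`). -/
noncomputable def repExponent {α : Type*} (x : ℕ → α) : EReal :=
  Filter.liminf (fun n : ℕ => (((repetitionLength x n : ℝ) / (n : ℝ) : ℝ) : EReal)) Filter.atTop

/-- The infinite word `x = x₁x₂…` over `{0, 1}` is a Sturmian word of slope `θ` (and intercept `ρ`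
for some real `ρ`): either `xₖ = ⌊(k+1)θ + ρ⌋ - ⌊kθ + ρ⌋` for all `k ≥ 1`, or
`xₖ = ⌈(k+1)θ + ρ⌉ - ⌈kθ + ρ⌉` for all `k ≥ 1`. Here `xₖ` is `x n` with `k = n + 1`.
It is meant for irrational `θ` in `(0, 1)`. -/
def IsSturmianOfSlope (θ : ℝ) (x : ℕ → Fin 2) : Prop :=
  ∃ ρ : ℝ,
    (∀ n : ℕ, (((x n : Fin 2) : ℕ) : ℤ) =
      ⌊((n : ℝ) + 1 + 1) * θ + ρ⌋ - ⌊((n : ℝ) + 1) * θ + ρ⌋) ∨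
    (∀ n : ℕ, (((x n : Fin 2) : ℕ) : ℤ) =
      ⌈((n : ℝ) + 1 + 1) * θ + ρ⌉ - ⌈((n : ℝ) + 1) * θ + ρ⌉)

/-- The spectrum of the exponents of repetition of the Sturmian words of slope `θ`. -/
def repSpectrum (θ : ℝ) : Set EReal :=
  {e | ∃ x : ℕ → Fin 2, IsSturmianOfSlope θ x ∧ repExponent x = e}

/-- `a 1, a 2, …` are the partial quotients of the (regular) continued fraction expansion
`θ = [⌊θ⌋; a₁, a₂, …]`; in particular the expansion is infinite. The value `a 0` is not used. -/
def HasPartialQuotients (θ : ℝ) (a : ℕ → ℕ) : Prop :=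
  ∀ k : ℕ, (GenContFract.of θ).partDens.get? k = some (a (k + 1) : ℝ)

/-- The value of the finite continued fraction `[c; d₁, …, dₘ]`. -/
noncomputable def finiteContFract (c : ℝ) : List ℝ → ℝ
  | [] => c
  | d :: l => c + 1 / finiteContFract d l

/-- The number `[1; 1 + aₖ, aₖ₋₁, …, a₁]` for `k = n + 1`. -/
noncomputable def reversedContFract (a : ℕ → ℕ) (n : ℕ) : ℝ :=
  finiteContFract 1
    ((1 + (a (n + 1) : ℝ)) :: (List.range n).reverse.map (fun i => (a (i + 1) : ℝ)))

/-! Write Q_n for `contFractDen a n` and E_n = |Q_n θ - P_n|. A Sturmian word codes an orbit of the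
rotation by θ; a factor recurring at distance d means that translation by dθ, less a fixed integer,
carries no point of an orbit segment across an integer. For d < Q_{m+1} this translation has size at
least E_m (`le_abs_mul_sub`), while Q_m + Q_{m+1} consecutive points meet every half-open interval
of length E_m modulo 1 (`exists_orbit_mem_Ico`). So r(n) ≥ n + Q_{m+1} once n + 1 ≥ Q_m + Q_{m+1}.
The worst n below Q_{m+1} + Q_{m+2} yields 1 + Q_{m+1} / (Q_{m+1} + Q_{m+2}), the reversed continued
fraction (`reversedContFract_eq`).

The bound is attained: from a suitable orbit point on, the period Q_{m+1} persists for Q_{m+1} +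
Q_{m+2} - 2 letters (`floor_add_den_sub`). Baire's theorem provides an intercept whose orbit reaches
such points early for infinitely many near-optimal m. -/

open Filter Topology

/-! ### Continued fractions as a Euclidean algorithm -/

/-- The denominators of the convergents of `[0; a₁, a₂, …]`, with index shifted by one:
`0, 1, a₁, a₂ a₁ + 1, …`. -/
def contFractDen (a : ℕ → ℕ) : ℕ → ℕ
  | 0 => 0
  | 1 => 1
  | n + 2 => a (n + 1) * contFractDen a (n + 1) + contFractDen a n

/-- The numerators of the convergents of `[0; a₁, a₂, …]`, with index shifted by one:
`1, 0, 1, a₂, …`. -/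
def contFractNum (a : ℕ → ℕ) : ℕ → ℕ
  | 0 => 1
  | 1 => 0
  | n + 2 => a (n + 1) * contFractNum a (n + 1) + contFractNum a n

/-- `E` is the sequence of remainders of the Euclidean algorithm for `1` and `θ` with
quotients `a 1, a 2, …`. -/
structure IsRemainderSeq (θ : ℝ) (a : ℕ → ℕ) (E : ℕ → ℝ) : Prop where
  zero : E 0 = 1
  one : E 1 = θ
  rec_eq : ∀ n, E (n + 2) = E n - a (n + 1) * E (n + 1)
  pos : ∀ n, 0 < E n
  lt : ∀ n, E (n + 1) < E n

/-- The complete remainders `θ, {1/θ}, …` of the continued fraction algorithm. -/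
noncomputable def gaussOrbit (θ : ℝ) : ℕ → ℝ
  | 0 => θ
  | n + 1 => Int.fract (gaussOrbit θ n)⁻¹

theorem gaussOrbit_spec {θ : ℝ} (hirr : Irrational θ) (h0 : 0 < θ) (h1 : θ < 1) (n : ℕ) :
    Irrational (gaussOrbit θ n) ∧ 0 < gaussOrbit θ n ∧ gaussOrbit θ n < 1 := by
  induction n with
  | zero => exact ⟨hirr, h0, h1⟩
  | succ n ih =>
    have hi : Irrational (gaussOrbit θ (n + 1)) :=
      (irrational_inv_iff.2 ih.1).sub_intCast ⌊(gaussOrbit θ n)⁻¹⌋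
    refine ⟨hi, lt_of_le_of_ne (Int.fract_nonneg _) hi.ne_zero.symm, Int.fract_lt_one _⟩

theorem partDens_of_gaussOrbit {θ : ℝ} (hirr : Irrational θ) (h0 : 0 < θ) (h1 : θ < 1)
    (n k : ℕ) : (GenContFract.of θ).partDens.get? (n + k) =
      (GenContFract.of (gaussOrbit θ n)).partDens.get? k := by
  induction n generalizing k with
  | zero => simp [gaussOrbit]
  | succ n ih =>
    obtain ⟨-, hp, hl⟩ := gaussOrbit_spec hirr h0 h1 n
    have hf : Int.fract (gaussOrbit θ n) = gaussOrbit θ n := Int.fract_eq_self.2 ⟨hp.le, hl⟩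
    rw [show n + 1 + k = n + (k + 1) by ring, ih]
    have h2 : (GenContFract.of (gaussOrbit θ (n + 1))).partDens.get? k =
        (GenContFract.of (gaussOrbit θ n)⁻¹).partDens.get? k := by
      simp only [GenContFract.partDens, Stream'.Seq.map_get?, gaussOrbit]
      cases k with
      | zero =>
        rw [GenContFract.of_s_head_aux, GenContFract.of_s_head_aux]
        simp [GenContFract.IntFractPair.stream, GenContFract.IntFractPair.of]
      | succ k =>
        rw [GenContFract.of_s_succ, GenContFract.of_s_succ, Int.fract_fract]
    rw [h2]
    simp only [GenContFract.partDens, Stream'.Seq.map_get?]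
    rw [GenContFract.of_s_succ, hf]

theorem HasPartialQuotients.eq_floor {θ : ℝ} {a : ℕ → ℕ} (ha : HasPartialQuotients θ a)
    (hirr : Irrational θ) (h0 : 0 < θ) (h1 : θ < 1) (n : ℕ) :
    (a (n + 1) : ℝ) = ⌊(gaussOrbit θ n)⁻¹⌋ := by
  obtain ⟨-, hp, hl⟩ := gaussOrbit_spec hirr h0 h1 n
  have hf : Int.fract (gaussOrbit θ n) = gaussOrbit θ n := Int.fract_eq_self.2 ⟨hp.le, hl⟩
  have h := ha n
  have hs : (GenContFract.of (gaussOrbit θ n)).s.get? 0 = _ :=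
    GenContFract.of_s_head (by rw [hf]; exact hp.ne')
  have h2 := partDens_of_gaussOrbit hirr h0 h1 n 0
  rw [add_zero, h] at h2
  simp only [GenContFract.partDens, Stream'.Seq.map_get?, hs, hf, Option.map_some,
    Option.some.injEq] at h2
  exact h2

theorem HasPartialQuotients.exists_isRemainderSeq {θ : ℝ} {a : ℕ → ℕ}
    (ha : HasPartialQuotients θ a) (hirr : Irrational θ) (h0 : 0 < θ) (h1 : θ < 1) :
    ∃ E, IsRemainderSeq θ a E := by
  have ht := gaussOrbit_spec hirr h0 h1
  have hp : ∀ n, 0 < ∏ i ∈ Finset.range n, gaussOrbit θ i := fun n =>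
    Finset.prod_pos fun i _ => (ht i).2.1
  -- With θ_n = `gaussOrbit θ n`, the recurrence for these products is θ_{n+1} = 1/θ_n - a_{n+1}.
  refine ⟨fun n => ∏ i ∈ Finset.range n, gaussOrbit θ i, by simp, by simp [gaussOrbit],
    fun n => ?_, hp, fun n => ?_⟩
  · have hne := (ht n).2.1.ne'
    simp only [Finset.prod_range_succ, ha.eq_floor hirr h0 h1, gaussOrbit, Int.fract]
    field_simp
  · simp only [Finset.prod_range_succ]
    exact mul_lt_of_lt_one_right (hp n) (ht n).2.2

/-! ### Denominators, remainders and best approximation -/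

namespace IsRemainderSeq

variable {θ : ℝ} {a : ℕ → ℕ} {E : ℕ → ℝ}

theorem one_le_quotient (h : IsRemainderSeq θ a E) (n : ℕ) : 1 ≤ a (n + 1) := by
  by_contra hc
  have h0 : a (n + 1) = 0 := by omega
  have h1 := h.rec_eq n
  have h2 := h.lt n
  have h3 := h.lt (n + 1)
  simp only [h0, Nat.cast_zero, zero_mul, sub_zero] at h1
  linarith

theorem add_le (h : IsRemainderSeq θ a E) (n : ℕ) : E (n + 1) + E (n + 2) ≤ E n := by
  have h1 : (1 : ℝ) ≤ a (n + 1) := by exact_mod_cast h.one_le_quotient n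
  have h2 := h.rec_eq n
  nlinarith [h.pos (n + 1)]

theorem antitone (h : IsRemainderSeq θ a E) : Antitone E :=
  antitone_nat_of_succ_le fun n => (h.lt n).le

theorem den_pos (h : IsRemainderSeq θ a E) (n : ℕ) : 0 < contFractDen a (n + 1) := by
  induction n with
  | zero => simp [contFractDen]
  | succ n ih =>
    simp only [contFractDen]
    exact Nat.add_pos_left (Nat.mul_pos (h.one_le_quotient n) ih) _

theorem den_add_le (h : IsRemainderSeq θ a E) (n : ℕ) :
    contFractDen a (n + 1) + contFractDen a n ≤ contFractDen a (n + 2) := by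
  simp only [contFractDen]
  have := Nat.le_mul_of_pos_left (contFractDen a (n + 1)) (h.one_le_quotient n)
  omega

theorem den_le_succ (h : IsRemainderSeq θ a E) (n : ℕ) :
    contFractDen a n ≤ contFractDen a (n + 1) := by
  cases n with
  | zero => simp [contFractDen]
  | succ n => exact (Nat.le_add_right _ _).trans (h.den_add_le n)

theorem le_den (h : IsRemainderSeq θ a E) (n : ℕ) : n ≤ contFractDen a (n + 1) := by
  induction n with
  | zero => simp
  | succ n ih =>
    rcases n with _ | n
    · exact h.den_pos 1
    · have h1 := h.den_add_le (n + 1)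
      have h2 := h.den_pos n
      simp only [add_assoc, Nat.reduceAdd] at *
      omega

theorem den_mul_sub_num (h : IsRemainderSeq θ a E) (n : ℕ) :
    contFractDen a n * θ - contFractNum a n = -(-1) ^ n * E n := by
  induction n using Nat.twoStepInduction with
  | zero => simp [contFractDen, contFractNum, h.zero]
  | one => simp [contFractDen, contFractNum, h.one]
  | more n ih1 ih2 =>
    simp only [contFractDen, contFractNum, h.rec_eq]
    push_cast
    rw [pow_succ] at ih2
    rw [pow_add]
    linear_combination ih1 + a (n + 1) * ih2

theorem det_eq (a : ℕ → ℕ) (n : ℕ) :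
    (contFractDen a (n + 1) : ℤ) * contFractNum a n - contFractDen a n * contFractNum a (n + 1) =
      (-1) ^ n := by
  induction n with
  | zero => simp [contFractDen, contFractNum]
  | succ n ih =>
    simp only [contFractDen, contFractNum]
    push_cast
    rw [pow_succ]
    linear_combination -ih

theorem den_mul_add (h : IsRemainderSeq θ a E) (n : ℕ) :
    contFractDen a (n + 1) * E n + contFractDen a n * E (n + 1) = 1 := by
  induction n with
  | zero => simp [contFractDen, h.zero]
  | succ n ih =>
    simp only [contFractDen, h.rec_eq]
    push_cast
    linear_combination ih

theorem tendsto_zero (h : IsRemainderSeq θ a E) : Tendsto E atTop (𝓝 0) := by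
  rw [← tendsto_add_atTop_iff_nat 1]
  refine squeeze_zero (fun n => (h.pos _).le) (fun n => ?_)
    (tendsto_one_div_add_atTop_nhds_zero_nat (𝕜 := ℝ))
  have h1 := h.den_mul_add (n + 1)
  have h2 : ((n + 1 : ℕ) : ℝ) ≤ contFractDen a (n + 2) := by exact_mod_cast h.le_den (n + 1)
  push_cast at h2
  have h3 : 0 ≤ (contFractDen a (n + 1) : ℝ) * E (n + 1 + 1) := by
    have := h.pos (n + 1 + 1)
    positivity
  rw [le_div_iff₀ (by positivity)]
  nlinarith [h.pos (n + 1)]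

/-- Best approximation: multiples of `θ` by positive integers below a denominator stay at
distance at least the preceding remainder from the integers. -/
theorem le_abs_mul_sub (h : IsRemainderSeq θ a E) {m d : ℕ} (hd : 1 ≤ d)
    (hd' : d < contFractDen a (m + 1)) (p : ℤ) : E m ≤ |d * θ - p| := by
  obtain ⟨u, hu⟩ : ∃ u : ℤ, u = contFractDen a m := ⟨_, rfl⟩
  obtain ⟨v, hv⟩ : ∃ v : ℤ, v = contFractDen a (m + 1) := ⟨_, rfl⟩
  obtain ⟨s, hs⟩ : ∃ s : ℤ, s = contFractNum a m := ⟨_, rfl⟩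
  obtain ⟨t, ht⟩ : ∃ t : ℤ, t = contFractNum a (m + 1) := ⟨_, rfl⟩
  have hdet : v * s - u * t = (-1) ^ m := by rw [hu, hv, hs, ht]; exact det_eq a m
  have hsq : ((-1 : ℤ) ^ m) * (-1) ^ m = 1 := by rw [← mul_pow]; simp
  have hd1 : (1 : ℤ) ≤ d := by exact_mod_cast hd
  have hd2 : (d : ℤ) < v := by rw [hv]; exact_mod_cast hd'
  have hu0 : 0 ≤ u := by rw [hu]; positivity
  -- X and Y are the coordinates of (d, p) in the unimodular basis (u, s), (v, t). As 0 < d < v, X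
  -- is nonzero and Y does not share its sign, so the two terms of `key` reinforce each other.
  obtain ⟨X, hX⟩ : ∃ X : ℤ, X = (-1) ^ m * (v * p - d * t) := ⟨_, rfl⟩
  obtain ⟨Y, hY⟩ : ∃ Y : ℤ, Y = (-1) ^ m * (d * s - u * p) := ⟨_, rfl⟩
  have h1 : (d : ℤ) = X * u + Y * v := by
    rw [hX, hY]; linear_combination (-(d : ℤ)) * hsq - (-1) ^ m * d * hdet
  have h2 : p = X * s + Y * t := by
    rw [hX, hY]; linear_combination (-p) * hsq - (-1) ^ m * p * hdet
  have e1 : (u : ℝ) * θ - s = -(-1) ^ m * E m := by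
    simpa [hu, hs] using h.den_mul_sub_num m
  have e2 : (v : ℝ) * θ - t = (-1) ^ m * E (m + 1) := by
    simpa [hv, ht, pow_succ] using h.den_mul_sub_num (m + 1)
  have key : d * θ - p = (-1) ^ m * (Y * E (m + 1) - X * E m) := by
    have h1' : (d : ℝ) = X * u + Y * v := by exact_mod_cast h1
    have h2' : (p : ℝ) = X * s + Y * t := by exact_mod_cast h2
    rw [h1', h2']
    linear_combination (X : ℝ) * e1 + (Y : ℝ) * e2
  rw [key, abs_mul, abs_pow, abs_neg, abs_one, one_pow, one_mul]
  have p1 := h.pos m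
  have p2 := h.pos (m + 1)
  rcases lt_trichotomy X 0 with hXn | hX0 | hXp
  · have hYp : 0 ≤ Y := by
      by_contra hc
      nlinarith
    have c1 : (X : ℝ) ≤ -1 := by exact_mod_cast Int.le_sub_one_of_lt hXn
    have c2 : (0 : ℝ) ≤ Y := by exact_mod_cast hYp
    refine le_trans ?_ (le_abs_self _)
    nlinarith [mul_nonneg c2 p2.le]
  · exfalso
    rw [hX0, zero_mul, zero_add] at h1
    have : 0 < Y := by
      by_contra hc
      nlinarith
    nlinarith
  · have hYn : Y ≤ 0 := by
      by_contra hc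
      nlinarith
    have c1 : (1 : ℝ) ≤ X := by exact_mod_cast hXp
    have c2 : (Y : ℝ) ≤ 0 := by exact_mod_cast hYn
    refine le_trans ?_ (neg_le_abs _)
    nlinarith [mul_nonneg (neg_nonneg.2 c2) p2.le]

end IsRemainderSeq

/-! ### Orbit segments meet every interval -/

/-- If `u` and `v` steps of the rotation by `φ` move by `α` and `β` in opposite directions, where
`β ≤ α`, then among `u + v` consecutive orbit points one lies in a given half-open interval of
length `α`. -/
theorem exists_orbit_mem_Ico {φ α β : ℝ} {u v : ℕ} {p p' : ℤ} (hβ : 0 < β) (hβα : β ≤ α)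
    (huv : 0 < u + v)
    (h : (u * φ - p = α ∧ v * φ - p' = -β) ∨ (u * φ - p = -α ∧ v * φ - p' = β)) (ρ c : ℝ) :
    ∃ l < u + v, ∃ z : ℤ, c ≤ l * φ + ρ + z ∧ l * φ + ρ + z < c + α := by
  by_contra! hc
  -- Below c, one can always move right by α or β within the index range, adding one of u, v or
  -- subtracting the other. Such a move cannot jump over an empty gap of length α, so the points
  -- climb forever below c.
  have step : ∀ l < u + v, ∀ z : ℤ, l * φ + ρ + z < c → ∃ l' < u + v, ∃ z' : ℤ,
      l' * φ + ρ + z' < c ∧ l * φ + ρ + z + β ≤ l' * φ + ρ + z' := by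
    intro l hl z hz
    suffices ∃ l' < u + v, ∃ z' : ℤ, l * φ + ρ + z + β ≤ l' * φ + ρ + z' ∧
        l' * φ + ρ + z' ≤ l * φ + ρ + z + α by
      obtain ⟨l', hl', z', h1, h2⟩ := this
      refine ⟨l', hl', z', ?_, h1⟩
      by_contra! h3
      linarith [hc l' hl' z' h3]
    rcases h with ⟨h1, h2⟩ | ⟨h1, h2⟩
    · rcases lt_or_ge l v with hlv | hlv
      · refine ⟨l + u, by omega, z - p, ?_⟩
        push_cast
        constructor <;> linarith
      · refine ⟨l - v, by omega, z + p', ?_⟩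
        push_cast [Nat.cast_sub hlv]
        constructor <;> linarith
    · rcases lt_or_ge l u with hlu | hlu
      · refine ⟨l + v, by omega, z - p', ?_⟩
        push_cast
        constructor <;> linarith
      · refine ⟨l - u, by omega, z + p, ?_⟩
        push_cast [Nat.cast_sub hlu]
        constructor <;> linarith
  have iter : ∀ n : ℕ, ∃ l < u + v, ∃ z : ℤ, l * φ + ρ + z < c ∧
      c - 2 + n * β ≤ l * φ + ρ + z := by
    intro n
    induction n with
    | zero =>
      refine ⟨0, huv, ⌈c - ρ⌉ - 1, ?_⟩
      have h1 := Int.ceil_lt_add_one (c - ρ)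
      have h2 := Int.le_ceil (c - ρ)
      push_cast
      constructor <;> linarith
    | succ n ih =>
      obtain ⟨l, hl, z, h1, h2⟩ := ih
      obtain ⟨l', hl', z', h3, h4⟩ := step l hl z h1
      refine ⟨l', hl', z', h3, ?_⟩
      push_cast
      linarith
  obtain ⟨n, hn⟩ := exists_nat_gt (2 / β)
  obtain ⟨l, -, z, h1, h2⟩ := iter n
  rw [div_lt_iff₀ hβ] at hn
  linarith

namespace IsRemainderSeq

variable {θ : ℝ} {a : ℕ → ℕ} {E : ℕ → ℝ}

theorem exists_orbit_mem_Ico (h : IsRemainderSeq θ a E) (m : ℕ) {φ : ℝ} (hφ : φ = θ ∨ φ = -θ)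
    (ρ c : ℝ) : ∃ l < contFractDen a m + contFractDen a (m + 1), ∃ z : ℤ,
      c ≤ l * φ + ρ + z ∧ l * φ + ρ + z < c + E m := by
  have e1 := h.den_mul_sub_num m
  have e2 := h.den_mul_sub_num (m + 1)
  have hpos : 0 < contFractDen a m + contFractDen a (m + 1) := by have := h.den_pos m; omega
  rcases hφ with rfl | rfl
  · refine _root_.exists_orbit_mem_Ico (p := contFractNum a m) (p' := contFractNum a (m + 1))
      (h.pos (m + 1)) (h.lt m).le hpos ?_ ρ c
    push_cast
    rw [e1, e2, pow_succ]
    rcases neg_one_pow_eq_or ℝ m with hs | hs <;> simp [hs]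
  · refine _root_.exists_orbit_mem_Ico (p := -contFractNum a m) (p' := -contFractNum a (m + 1))
      (h.pos (m + 1)) (h.lt m).le hpos ?_ ρ c
    push_cast
    rw [show (contFractDen a m : ℝ) * -θ - -(contFractNum a m : ℝ) =
      -(contFractDen a m * θ - contFractNum a m) by ring,
      show (contFractDen a (m + 1) : ℝ) * -θ - -(contFractNum a (m + 1) : ℝ) =
      -(contFractDen a (m + 1) * θ - contFractNum a (m + 1)) by ring, e1, e2, pow_succ]
    rcases neg_one_pow_eq_or ℝ m with hs | hs <;> simp [hs]

/-- Otherwise translation by dφ - c, of size at least E_m, would never change the side of an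
integer; but some orbit point lies within E_m of an integer, on the side from which it must cross.
-/
theorem not_floor_shift_const (h : IsRemainderSeq θ a E) {m d : ℕ} (hd : 1 ≤ d)
    (hd' : d < contFractDen a (m + 1)) {φ : ℝ} (hφ : φ = θ ∨ φ = -θ) (ρ : ℝ) (i n : ℕ)
    (hn : contFractDen a m + contFractDen a (m + 1) ≤ n + 1) (c : ℤ) :
    ¬ ∀ l ≤ n, ⌊((i + l + d : ℕ) : ℝ) * φ + ρ⌋ - ⌊((i + l : ℕ) : ℝ) * φ + ρ⌋ = c := by
  intro hc
  have he : E m ≤ |d * φ - c| := by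
    rcases hφ with rfl | rfl
    · exact h.le_abs_mul_sub hd hd' c
    · have := h.le_abs_mul_sub hd hd' (-c)
      rw [← abs_neg]
      convert this using 2
      push_cast
      ring
  have hb : ∀ l < contFractDen a m + contFractDen a (m + 1), ∀ z : ℤ,
      ((l * φ + (i * φ + ρ) + z < 0 ↔ l * φ + (i * φ + ρ) + z + (d * φ - c) < 0)) := by
    intro l hl z
    have h1 := hc l (by omega)
    have h2 : ⌊((i + l : ℕ) : ℝ) * φ + ρ⌋ = ⌊((i + l + d : ℕ) : ℝ) * φ + ρ⌋ - c := by omega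
    have e1 : l * φ + (i * φ + ρ) + z < 0 ↔ ⌊((i + l : ℕ) : ℝ) * φ + ρ⌋ < -z := by
      rw [Int.floor_lt]
      push_cast
      constructor <;> intro <;> linarith
    have e2 : l * φ + (i * φ + ρ) + z + (d * φ - c) < 0 ↔
        ⌊((i + l + d : ℕ) : ℝ) * φ + ρ⌋ - c < -z := by
      rw [sub_lt_iff_lt_add, Int.floor_lt]
      push_cast
      constructor <;> intro <;> linarith
    rw [e1, e2, h2]
  rcases le_abs.1 he with h1 | h1
  · obtain ⟨l, hl, z, h2, h3⟩ := h.exists_orbit_mem_Ico m hφ (i * φ + ρ) (-E m)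
    have := (hb l hl z).1 (by linarith)
    linarith
  · obtain ⟨l, hl, z, h2, h3⟩ := h.exists_orbit_mem_Ico m hφ (i * φ + ρ) 0
    have := (hb l hl z).2 (by linarith)
    linarith

end IsRemainderSeq

/-! ### The lower bound -/

/-- The letters of a Sturmian word are determined by the increments of the integer parts along an
orbit of the rotation by `θ` or by `-θ`. -/
theorem IsSturmianOfSlope.exists_floor {θ : ℝ} {x : ℕ → Fin 2} (hx : IsSturmianOfSlope θ x) :
    ∃ φ ρ : ℝ, (φ = θ ∨ φ = -θ) ∧ ∀ m n : ℕ, x m = x n →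
      ⌊((m + 1 : ℕ) : ℝ) * φ + ρ⌋ - ⌊(m : ℝ) * φ + ρ⌋ =
        ⌊((n + 1 : ℕ) : ℝ) * φ + ρ⌋ - ⌊(n : ℝ) * φ + ρ⌋ := by
  obtain ⟨ρ, h | h⟩ := hx
  · refine ⟨θ, θ + ρ, Or.inl rfl, fun m n hmn => ?_⟩
    have e := h m
    rw [hmn, h n] at e
    convert e.symm using 3 <;> push_cast <;> ring
  · refine ⟨-θ, -θ - ρ, Or.inr rfl, fun m n hmn => ?_⟩
    have e := h m
    rw [hmn, h n] at e
    have hf : ∀ y : ℝ, ⌈y⌉ = -⌊-y⌋ := fun y => by rw [Int.floor_neg, neg_neg]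
    simp only [hf] at e
    have e1 : ∀ k : ℕ, ((k + 1 : ℕ) : ℝ) * -θ + (-θ - ρ) = -((k + 1 + 1) * θ + ρ) := by
      intro k; push_cast; ring
    have e2 : ∀ k : ℕ, (k : ℝ) * -θ + (-θ - ρ) = -((k + 1) * θ + ρ) := by
      intro k; ring
    simp only [e1, e2]
    omega

theorem IsRemainderSeq.add_den_le_repetitionLength {θ : ℝ} {a : ℕ → ℕ} {E : ℕ → ℝ}
    (h : IsRemainderSeq θ a E) {x : ℕ → Fin 2} (hx : IsSturmianOfSlope θ x) {m n : ℕ}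
    (hn : contFractDen a m + contFractDen a (m + 1) ≤ n + 1) :
    n + contFractDen a (m + 1) ≤ repetitionLength x n := by
  obtain ⟨φ, ρ, hφ, hF⟩ := hx.exists_floor
  obtain ⟨i, j, hij, hr, hl⟩ := Nat.sInf_mem (repetitionLengths_nonempty x n)
  rw [repetitionLength, hr]
  by_contra! hlt
  obtain ⟨d, rfl⟩ := Nat.exists_eq_add_of_lt hij
  -- Agreement of n letters, which are increments, makes the difference constant at n + 1 positions.
  refine h.not_floor_shift_const (m := m) (d := d + 1) (by omega) (by omega) hφ ρ i n hn
    (⌊((i + 0 + (d + 1) : ℕ) : ℝ) * φ + ρ⌋ - ⌊((i + 0 : ℕ) : ℝ) * φ + ρ⌋) fun l hln => ?_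
  induction l with
  | zero => rfl
  | succ l ih =>
    have h1 := ih (by omega)
    have h2 := hF _ _ (hl l (by omega))
    have e1 : i + (l + 1) + (d + 1) = i + d + 1 + l + 1 := by ring
    have e2 : i + l + (d + 1) = i + d + 1 + l := by ring
    rw [e1, ← add_assoc i l 1]
    rw [e2] at h1
    omega

/-- The mirror formula: dividing the recurrence by Q_{n+1} peels off the last partial quotient. -/
theorem finiteContFract_reverse {a : ℕ → ℕ} (hpos : ∀ n, 0 < contFractDen a (n + 1)) (n : ℕ)
    (c : ℝ) : finiteContFract c ((List.range n).reverse.map fun i => (a (i + 1) : ℝ)) =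
      c + contFractDen a n / contFractDen a (n + 1) := by
  induction n generalizing c with
  | zero => simp [finiteContFract, contFractDen]
  | succ n ih =>
    rw [List.range_succ, List.reverse_append, List.reverse_singleton, List.singleton_append,
      List.map_cons, finiteContFract, ih]
    have h1 : (contFractDen a (n + 1) : ℝ) ≠ 0 := by exact_mod_cast (hpos n).ne'
    have h2 : (contFractDen a (n + 1 + 1) : ℝ) = a (n + 1) * contFractDen a (n + 1) +
        contFractDen a n := by simp only [contFractDen]; push_cast; ring
    rw [h2]
    field_simp

theorem reversedContFract_eq {a : ℕ → ℕ} (hpos : ∀ n, 0 < contFractDen a (n + 1)) (n : ℕ) :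
    reversedContFract a n = 1 + (contFractDen a (n + 1) : ℝ) /
      (contFractDen a (n + 1) + contFractDen a (n + 2)) := by
  rw [reversedContFract, finiteContFract, finiteContFract_reverse hpos]
  have h1 : (contFractDen a (n + 1) : ℝ) ≠ 0 := by exact_mod_cast (hpos n).ne'
  have h2 : (contFractDen a (n + 2) : ℝ) = a (n + 1) * contFractDen a (n + 1) +
      contFractDen a n := by simp only [contFractDen]; push_cast; ring
  have h3 : 1 + (a (n + 1) : ℝ) + contFractDen a n / contFractDen a (n + 1) =
      (contFractDen a (n + 1) + contFractDen a (n + 2)) / contFractDen a (n + 1) := by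
    rw [h2]
    field_simp
    ring
  rw [h3, one_div_div]

theorem IsRemainderSeq.exists_reversedContFract_le {θ : ℝ} {a : ℕ → ℕ} {E : ℕ → ℝ}
    (h : IsRemainderSeq θ a E) {x : ℕ → Fin 2} (hx : IsSturmianOfSlope θ x) (K : ℕ) {n : ℕ}
    (hn : contFractDen a K + contFractDen a (K + 1) ≤ n) :
    ∃ m ≥ K, reversedContFract a m ≤ (repetitionLength x n : ℝ) / n := by
  have hex : ∃ m, n + 1 < contFractDen a (m + 1) + contFractDen a (m + 2) :=
    ⟨n + 1, by have h1 : n + 1 ≤ contFractDen a (n + 1 + 1) := h.le_den (n + 1)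
               have h2 : n + 2 ≤ contFractDen a (n + 1 + 2) := h.le_den (n + 2)
               omega⟩
  -- Minimality of m gives Q_m + Q_{m+1} ≤ n + 1, the range where distances below Q_{m+1} are
  -- excluded.
  obtain ⟨m, hm, hmin⟩ : ∃ m, n + 1 < contFractDen a (m + 1) + contFractDen a (m + 2) ∧
      ∀ k < m, ¬ n + 1 < contFractDen a (k + 1) + contFractDen a (k + 2) :=
    ⟨Nat.find hex, Nat.find_spec hex, fun k hk => Nat.find_min hex hk⟩
  have hmono : Monotone (contFractDen a) := monotone_nat_of_le_succ h.den_le_succ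
  have hKm : K ≤ m := by
    by_contra! hc
    have h1 := hmono (show m + 1 ≤ K from hc)
    have h2 := hmono (show m + 2 ≤ K + 1 by omega)
    omega
  have hn0 : 0 < n := by have := h.den_pos K; omega
  have hle : contFractDen a m + contFractDen a (m + 1) ≤ n + 1 := by
    rcases m with _ | m
    · simp [contFractDen]
    · exact not_lt.1 (hmin m (by omega))
  have hr := h.add_den_le_repetitionLength hx hle
  refine ⟨m, hKm, ?_⟩
  rw [reversedContFract_eq h.den_pos]
  have hr' : (n : ℝ) + contFractDen a (m + 1) ≤ repetitionLength x n := by exact_mod_cast hr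
  have hm' : (n : ℝ) ≤ contFractDen a (m + 1) + contFractDen a (m + 2) := by
    exact_mod_cast (by omega : n ≤ contFractDen a (m + 1) + contFractDen a (m + 2))
  have hn' : (0 : ℝ) < n := by exact_mod_cast hn0
  calc _ ≤ 1 + (contFractDen a (m + 1) : ℝ) / n := by gcongr
    _ = (n + contFractDen a (m + 1)) / n := by field_simp
    _ ≤ _ := by gcongr

theorem IsRemainderSeq.liminf_le_repExponent {θ : ℝ} {a : ℕ → ℕ} {E : ℕ → ℝ}
    (h : IsRemainderSeq θ a E) {x : ℕ → Fin 2} (hx : IsSturmianOfSlope θ x) :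
    liminf (fun n : ℕ => ((reversedContFract a n : ℝ) : EReal)) atTop ≤ repExponent x := by
  refine le_of_forall_lt fun b hb => ?_
  obtain ⟨b', hbb, hb'⟩ := exists_between hb
  refine hbb.trans_le (le_liminf_of_le (by isBoundedDefault) ?_)
  obtain ⟨K, hK⟩ := eventually_atTop.1 (eventually_lt_of_lt_liminf hb')
  filter_upwards [eventually_ge_atTop (contFractDen a K + contFractDen a (K + 1))] with n hn
  obtain ⟨m, hm, hle⟩ := h.exists_reversedContFract_le hx K hn
  exact (hK m hm).le.trans (EReal.coe_le_coe_iff.2 hle)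

/-! ### Long stretches of period Q_{m+1} -/

namespace IsRemainderSeq

variable {θ : ℝ} {a : ℕ → ℕ} {E : ℕ → ℝ}

/-- The forbidden displacements of an orbit during its first `Q m + Q (m + 1)` steps. -/
theorem not_mem_Ioo_of_lt (h : IsRemainderSeq θ a E) {m l : ℕ} (hl : 1 ≤ l)
    (hl' : l < contFractDen a (m + 1) + contFractDen a (m + 2)) (p : ℤ) :
    ¬ (-E (m + 2) < (-1) ^ m * (l * θ - p) ∧ (-1) ^ m * (l * θ - p) < E (m + 1)) := by
  rintro ⟨h1, h2⟩
  have habs : ∀ y : ℝ, |(-1) ^ m * y| = |y| := fun y => by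
    rw [abs_mul, abs_pow, abs_neg, abs_one, one_pow, one_mul]
  rcases lt_or_ge l (contFractDen a (m + 2)) with hlt | hge
  · have h3 := h.le_abs_mul_sub hl hlt p
    rw [← habs] at h3
    have h4 := h.lt (m + 1)
    rcases le_abs.1 h3 with h5 | h5 <;> linarith
  · obtain ⟨l', rfl⟩ := Nat.exists_eq_add_of_le hge
    have e := h.den_mul_sub_num (m + 2)
    have hsq : ((-1 : ℝ) ^ m) * (-1) ^ m = 1 := by rw [← mul_pow]; simp
    -- Removing Q_{m+2} steps puts the signed displacement in (0, E_{m+1} + E_{m+2}), hence below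
    -- E_m, although l' < Q_{m+1}.
    have e2 : (-1) ^ m * (l' * θ - (p - contFractNum a (m + 2) : ℤ)) =
        (-1) ^ m * ((contFractDen a (m + 2) + l' : ℕ) * θ - p) + E (m + 2) := by
      rw [pow_add] at e
      push_cast
      linear_combination (-(-1) ^ m) * e + E (m + 2) * hsq
    have h5 : E m ≤ |l' * θ - (p - contFractNum a (m + 2) : ℤ)| := by
      rcases Nat.eq_zero_or_pos l' with rfl | hpos
      · simp only [Nat.cast_zero, zero_mul, zero_sub, abs_neg]
        have hne : p - contFractNum a (m + 2) ≠ 0 := by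
          intro h0
          rw [h0] at e2
          simp only [Nat.cast_zero, zero_mul, Int.cast_zero, sub_zero, mul_zero] at e2
          linarith
        have h6 : (1 : ℝ) ≤ |((p - contFractNum a (m + 2) : ℤ) : ℝ)| := by
          exact_mod_cast Int.one_le_abs hne
        have := h.antitone (Nat.zero_le m)
        rw [h.zero] at this
        linarith
      · exact h.le_abs_mul_sub hpos (by omega) _
    rw [← habs, e2] at h5
    have h6 := h.add_le m
    have h7 := h.pos m
    rcases le_abs.1 h5 with h8 | h8 <;> linarith

/-- If the orbit is in the part of the interval of length `E (m + 1)` with the longest return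
time, then the increments over `Q (m + 1)` steps stay constant as long as possible. -/
theorem floor_add_den_sub (h : IsRemainderSeq θ a E) {m : ℕ} {y : ℝ} {z : ℤ}
    (hy : -E (m + 1) < (-1) ^ m * (y - z))
    (hy' : (-1) ^ m * (y - z) < -E (m + 1) + E (m + 2)) {l : ℕ} (hl : 1 ≤ l)
    (hl' : l < contFractDen a (m + 1) + contFractDen a (m + 2)) :
    ⌊((l + contFractDen a (m + 1) : ℕ) : ℝ) * θ + y⌋ - ⌊(l : ℝ) * θ + y⌋ =
      contFractNum a (m + 1) := by
  have hno := h.not_mem_Ioo_of_lt hl hl'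
  have e := h.den_mul_sub_num (m + 1)
  have e1 : ((l + contFractDen a (m + 1) : ℕ) : ℝ) * θ + y =
      (l * θ + y) + (-1) ^ m * E (m + 1) + (contFractNum a (m + 1) : ℤ) := by
    rw [pow_succ] at e
    push_cast
    linear_combination e
  rw [e1, Int.floor_add_intCast]
  suffices ⌊(l * θ + y) + (-1) ^ m * E (m + 1)⌋ = ⌊(l : ℝ) * θ + y⌋ by rw [this]; ring
  have f1 := Int.floor_le ((l : ℝ) * θ + y)
  have f2 := Int.lt_floor_add_one ((l : ℝ) * θ + y)
  have hp := h.pos (m + 1)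
  -- Only points of this interval could cross an integer under the move by (-1)^m E_{m+1}; both ends
  -- are included to serve both parities of m. A return to it would be a forbidden displacement.
  have no : ∀ w : ℤ, ¬ (-E (m + 1) ≤ (-1) ^ m * (l * θ + y - w) ∧
      (-1) ^ m * (l * θ + y - w) ≤ 0) := by
    rintro w ⟨g1, g2⟩
    refine hno (w - z) ⟨?_, ?_⟩ <;> push_cast <;> linarith
  rw [Int.floor_eq_iff]
  rcases neg_one_pow_eq_or ℝ m with hs | hs
  · have := no (⌊(l : ℝ) * θ + y⌋ + 1)
    rw [hs] at this ⊢
    push_cast at this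
    refine ⟨by linarith, ?_⟩
    by_contra! hc
    exact this ⟨by linarith, by linarith⟩
  · have := no ⌊(l : ℝ) * θ + y⌋
    rw [hs] at this ⊢
    refine ⟨?_, by linarith⟩
    by_contra! hc
    exact this ⟨by linarith, by linarith⟩

end IsRemainderSeq

/-! ### Attaining the bound by Baire category -/

/-- The lower Sturmian word of slope `θ` and intercept `ρ`. -/
noncomputable def lowerSturmian (θ ρ : ℝ) (n : ℕ) : Fin 2 :=
  if ⌊((n : ℝ) + 1 + 1) * θ + ρ⌋ - ⌊((n : ℝ) + 1) * θ + ρ⌋ = 0 then 0 else 1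

theorem isSturmianOfSlope_lowerSturmian {θ : ℝ} (h0 : 0 < θ) (h1 : θ < 1) (ρ : ℝ) :
    IsSturmianOfSlope θ (lowerSturmian θ ρ) := by
  refine ⟨ρ, Or.inl fun n => ?_⟩
  have e : ((n : ℝ) + 1 + 1) * θ + ρ = ((n : ℝ) + 1) * θ + ρ + θ := by ring
  have l1 : ⌊((n : ℝ) + 1) * θ + ρ⌋ ≤ ⌊((n : ℝ) + 1 + 1) * θ + ρ⌋ :=
    Int.floor_le_floor (by linarith)
  have l2 : ⌊((n : ℝ) + 1 + 1) * θ + ρ⌋ ≤ ⌊((n : ℝ) + 1) * θ + ρ⌋ + 1 := by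
    rw [← Int.floor_add_one]
    exact Int.floor_le_floor (by linarith)
  unfold lowerSturmian
  split_ifs with hz
  · simpa using hz.symm
  · simp only [Fin.val_one, Nat.cast_one]
    omega

theorem div_le_of_early {q n i M r : ℕ} {c b b' : ℝ} (hc : c = 1 + (q : ℝ) / (n + 2))
    (hcb : c < b) (hbb' : b < b') (hM : 4 / (b' - b) < M) (hi : M * (i + 1) ≤ q) (hqn : q ≤ n)
    (hn : M ≤ n) (hr : r ≤ i + 1 + q + n) : (r : ℝ) / n ≤ b' := by
  have hε : 0 < b' - b := by linarith
  have hM0 : (0 : ℝ) < M := lt_trans (by positivity) hM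
  have hn' : (M : ℝ) ≤ n := by exact_mod_cast hn
  have hn0 : (0 : ℝ) < n := hM0.trans_le hn'
  have hqn' : (q : ℝ) ≤ n := by exact_mod_cast hqn
  have hr' : (r : ℝ) ≤ i + 1 + q + n := by exact_mod_cast hr
  have hi' : (M : ℝ) * (i + 1) ≤ q := by exact_mod_cast hi
  rw [div_lt_iff₀ hε] at hM
  obtain ⟨s, hs⟩ : ∃ s, s = (q : ℝ) / (n + 2) := ⟨_, rfl⟩
  have hq : (q : ℝ) = s * (n + 2) := by rw [hs]; field_simp
  have hs1 : s ≤ 1 := by rw [hs, div_le_one (by positivity)]; linarith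
  have hsb : s < b - 1 := by linarith
  have h1 : (i : ℝ) + 1 ≤ (b' - b) / 4 * n := by
    have h2 : 4 * ((i : ℝ) + 1) ≤ M * (b' - b) * (i + 1) := by gcongr
    have h3 : M * ((i : ℝ) + 1) * (b' - b) ≤ n * (b' - b) := by gcongr; linarith
    linarith
  have h4 : M * (b' - b) ≤ n * (b' - b) := by gcongr
  have h5 : s * n ≤ (b - 1) * n := by gcongr
  rw [div_le_iff₀ hn0]
  linarith

namespace IsRemainderSeq

variable {θ : ℝ} {a : ℕ → ℕ} {E : ℕ → ℝ}

theorem repetitionLength_lowerSturmian_le (h : IsRemainderSeq θ a E) {ρ : ℝ} {m i : ℕ} {z : ℤ}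
    (hy : -E (m + 1) < (-1) ^ m * (((i : ℝ) + 1) * θ + ρ - z))
    (hy' : (-1) ^ m * (((i : ℝ) + 1) * θ + ρ - z) < -E (m + 1) + E (m + 2)) {n : ℕ}
    (hn : n + 2 ≤ contFractDen a (m + 1) + contFractDen a (m + 2)) :
    repetitionLength (lowerSturmian θ ρ) n ≤ i + 1 + contFractDen a (m + 1) + n := by
  -- The match starts at i + 1 because the period is only controlled from l = 1 on.
  refine Nat.sInf_le ⟨i + 1, i + 1 + contFractDen a (m + 1), by have := h.den_pos m; omega, rfl,
    fun l hl => ?_⟩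
  have g1 := h.floor_add_den_sub hy hy' (l := l + 1) (by omega) (by omega)
  have g2 := h.floor_add_den_sub hy hy' (l := l + 2) (by omega) (by omega)
  unfold lowerSturmian
  have e1 : (((i + 1 + l : ℕ) : ℝ) + 1) * θ + ρ =
    ((l + 1 : ℕ) : ℝ) * θ + ((i + 1) * θ + ρ) := by push_cast; ring
  have e2 : (((i + 1 + l : ℕ) : ℝ) + 1 + 1) * θ + ρ =
    ((l + 2 : ℕ) : ℝ) * θ + ((i + 1) * θ + ρ) := by push_cast; ring
  have e3 : (((i + 1 + contFractDen a (m + 1) + l : ℕ) : ℝ) + 1) * θ + ρ =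
    ((l + 1 + contFractDen a (m + 1) : ℕ) : ℝ) * θ + ((i + 1) * θ + ρ) := by push_cast; ring
  have e4 : (((i + 1 + contFractDen a (m + 1) + l : ℕ) : ℝ) + 1 + 1) * θ + ρ =
    ((l + 2 + contFractDen a (m + 1) : ℕ) : ℝ) * θ + ((i + 1) * θ + ρ) := by push_cast; ring
  rw [e1, e2, e3, e4]
  congr 2
  omega

/-- The intercepts whose orbit enters, early and for some late `m` satisfying `S`, the part of the
interval of length `E (m + 1)` with the longest return time. -/
def earlyIntercepts (θ : ℝ) (a : ℕ → ℕ) (E : ℕ → ℝ) (S : ℕ → Prop) (M : ℕ) : Set ℝ :=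
  {ρ | ∃ m ≥ M, S m ∧ ∃ (i : ℕ) (z : ℤ), M * (i + 1) ≤ contFractDen a (m + 1) ∧
    -E (m + 1) < (-1) ^ m * (((i : ℝ) + 1) * θ + ρ - z) ∧
    (-1) ^ m * (((i : ℝ) + 1) * θ + ρ - z) < -E (m + 1) + E (m + 2)}

theorem isOpen_earlyIntercepts (S : ℕ → Prop) (M : ℕ) :
    IsOpen (earlyIntercepts θ a E S M) := by
  have : earlyIntercepts θ a E S M = ⋃ (m : ℕ) (i : ℕ) (z : ℤ)
      (_ : m ≥ M ∧ S m ∧ M * (i + 1) ≤ contFractDen a (m + 1)),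
      {ρ | -E (m + 1) < (-1) ^ m * (((i : ℝ) + 1) * θ + ρ - z)} ∩
      {ρ | (-1) ^ m * (((i : ℝ) + 1) * θ + ρ - z) < -E (m + 1) + E (m + 2)} := by
    ext ρ
    simp only [earlyIntercepts, Set.mem_ofPred_eq, Set.mem_iUnion, Set.mem_inter_iff]
    constructor
    · rintro ⟨m, hm, hS, i, z, hM, h1, h2⟩
      exact ⟨m, i, z, ⟨hm, hS, hM⟩, h1, h2⟩
    · rintro ⟨m, i, z, ⟨hm, hS, hM⟩, h1, h2⟩
      exact ⟨m, hm, hS, i, z, hM, h1, h2⟩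
  rw [this]
  refine isOpen_iUnion fun m => isOpen_iUnion fun i => isOpen_iUnion fun z =>
    isOpen_iUnion fun _ => (isOpen_lt ?_ ?_).inter (isOpen_lt ?_ ?_) <;> fun_prop

theorem dense_earlyIntercepts (h : IsRemainderSeq θ a E) {S : ℕ → Prop}
    (hS : ∃ᶠ m in atTop, S m) (M : ℕ) : Dense (earlyIntercepts θ a E S M) := by
  rw [Metric.dense_iff]
  intro ρ r hr
  have hE : ∀ᶠ m in atTop, E m < r / 2 := h.tendsto_zero.eventually_lt_const (by linarith)
  obtain ⟨k, hk⟩ := hE.exists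
  -- The time i is fixed before m, so that a large m makes it early. A small change of ρ then moves
  -- this orbit point, already near an integer, to the midpoint w of the target interval.
  obtain ⟨i, -, z, hz1, hz2⟩ := h.exists_orbit_mem_Ico k (Or.inl rfl) (θ + ρ) 0
  have hE' : ∀ᶠ m in atTop, E (m + 1) < r / 2 := (tendsto_add_atTop_nat 1).eventually hE
  obtain ⟨m, hSm, hEm, hm⟩ := (hS.and_eventually
    (hE'.and (eventually_ge_atTop (M + M * (i + 1))))).exists
  have p1 := h.pos (m + 1)
  have p2 := h.pos (m + 2)
  have p3 := h.lt (m + 1)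
  have hsq : ((-1 : ℝ) ^ m) * (-1) ^ m = 1 := by rw [← mul_pow]; simp
  obtain ⟨w, hw⟩ : ∃ w, w = -E (m + 1) + E (m + 2) / 2 := ⟨_, rfl⟩
  refine ⟨-(i + 1) * θ - z + (-1) ^ m * w, ?_, m, by omega, hSm, i, -z, ?_, ?_⟩
  · rw [Metric.mem_ball, Real.dist_eq, abs_lt]
    rcases neg_one_pow_eq_or ℝ m with hs | hs <;> rw [hs] <;> constructor <;> linarith
  · have := h.le_den m
    omega
  · have e : (-1 : ℝ) ^ m * (((i : ℝ) + 1) * θ + (-(i + 1) * θ - z + (-1) ^ m * w) - (-z : ℤ)) =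
        w := by
      push_cast
      linear_combination w * hsq
    rw [e]
    constructor <;> linarith

theorem exists_lowerSturmian_repExponent_le (h : IsRemainderSeq θ a E) :
    ∃ ρ, repExponent (lowerSturmian θ ρ) ≤
      liminf (fun n : ℕ => ((reversedContFract a n : ℝ) : EReal)) atTop := by
  set L := liminf (fun n : ℕ => ((reversedContFract a n : ℝ) : EReal)) atTop
  have hfreq : ∀ b : {b : ℚ // L < ((b : ℝ) : EReal)},
      ∃ᶠ m in atTop, reversedContFract a m < (b : ℚ) := fun b => by
    have := frequently_lt_of_liminf_lt (by isBoundedDefault) b.2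
    exact this.mono fun m hm => EReal.coe_lt_coe_iff.1 hm
  have hd : ∀ p : {b : ℚ // L < ((b : ℝ) : EReal)} × ℕ,
      Dense (earlyIntercepts θ a E (fun m => reversedContFract a m < (p.1 : ℚ)) p.2) :=
    fun p => h.dense_earlyIntercepts (hfreq p.1) p.2
  -- Rational bounds b keep the family of open dense sets countable.
  obtain ⟨ρ, hρ⟩ :=
    (dense_iInter_of_isOpen (fun p => isOpen_earlyIntercepts _ _) hd).nonempty
  refine ⟨ρ, le_of_forall_gt fun c hc => ?_⟩
  obtain ⟨b, hb, hbc⟩ := EReal.lt_iff_exists_rat_btwn.1 hc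
  obtain ⟨b', hbb', hb'c⟩ := EReal.lt_iff_exists_rat_btwn.1 hbc
  have hbb : (b : ℝ) < b' := EReal.coe_lt_coe_iff.1 hbb'
  refine lt_of_le_of_lt (liminf_le_of_frequently_le' ?_) hb'c
  rw [frequently_atTop]
  intro N
  obtain ⟨M₀, hM₀⟩ := exists_nat_gt (4 / ((b' : ℝ) - b))
  obtain ⟨m, hm, hlt, i, z, hi, hy, hy'⟩ := Set.mem_iInter.1 hρ (⟨b, hb⟩, M₀ + N + 4)
  have g1 : m ≤ contFractDen a (m + 1) := h.le_den m
  have g2 : m + 1 ≤ contFractDen a (m + 2) := h.le_den (m + 1)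
  -- The longest n allowed by the period; the loss of 2 and the delay i + 1 are absorbed between b
  -- and b'.
  obtain ⟨n, hn⟩ := Nat.exists_eq_add_of_le'
    (show 2 ≤ contFractDen a (m + 1) + contFractDen a (m + 2) by omega)
  refine ⟨n, by omega, EReal.coe_le_coe_iff.2 ?_⟩
  have hr := h.repetitionLength_lowerSturmian_le hy hy' hn.ge
  have hrat := reversedContFract_eq h.den_pos m
  have hn' : (contFractDen a (m + 1) + contFractDen a (m + 2) : ℝ) = n + 2 := by
    exact_mod_cast hn
  rw [hn'] at hrat
  refine div_le_of_early hrat hlt hbb (hM₀.trans_le ?_) hi (by omega) (by omega) hr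
  exact_mod_cast (by omega : M₀ ≤ M₀ + N + 4)

end IsRemainderSeq

theorem mainTheorem1 (θ : ℝ) (hirr : Irrational θ) (h0 : 0 < θ) (h1 : θ < 1)
    (a : ℕ → ℕ) (ha : HasPartialQuotients θ a)
    (hbdd : ∃ B : ℕ, ∀ k : ℕ, 1 ≤ k → a k ≤ B) :
    IsLeast (repSpectrum θ)
      (Filter.liminf (fun n : ℕ => ((reversedContFract a n : ℝ) : EReal)) Filter.atTop) := by
  obtain ⟨E, hE⟩ := ha.exists_isRemainderSeq hirr h0 h1
  refine ⟨?_, ?_⟩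
  · obtain ⟨ρ, hρ⟩ := hE.exists_lowerSturmian_repExponent_le
    have hx := isSturmianOfSlope_lowerSturmian h0 h1 ρ
    exact ⟨_, hx, le_antisymm hρ (hE.liminf_le_repExponent hx)⟩
  · rintro e ⟨x, hx, rfl⟩
    exact hE.liminf_le_repExponent hx
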